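/- **Proposition 2.8.** Let $\boldsymbol\lambda=\{\lambda_n\}_{n\ge 0}$ be a bounded sequence of positive real numbers and let $W$ be the unilateral weighted shift on $\ell^2$ (complex, square summable sequences) with weights $\boldsymbol\lambda$, that is, the bounded operator with $We_n=\lambda_ne_{n+1}$ for all $n\ge 0$. Assume that $W$ is conditionally positive definite (CPD), i.e. for every $h\in\ell^2$ the sequence $\gamma_n=\|W^nh\|^2$ satisfies $\sum_{i,j=0}^{k}\gamma_{i+j}c_i\bar c_j\ge 0$ for all $k\ge 0$ and all $c_0,\dots,c_k\in\mathbb C$ with $\sum_{j=0}^k c_j=0$. Then there is a unique triplet $(\mathfrak b,\mathfrak c,\nu)$, called the scalar representing triplet of $W$, consisting of $\mathfrak b\in\mathbb R$, $\mathfrak c\in[0,\infty)$ and a finite compactly supported Borel measure $\nu$ on $[0,\infty)$ with $\nu(\{1\})=0$, such that $$\prod_{j=0}^{n-1}\lambda_j^2 = 1+\mathfrak b n+\mathfrak c n^2+\int_{[0,\infty)}Q_n\,d\nu,\quad n\ge 0,\qquad Q_n(x)=\sum_{j=0}^{n-2}(n-j-1)x^j\ \ (Q_0=Q_1=0).$$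 Assume further that $W$ is of type I ($\nu=0$ and $\mathfrak c=0$) or of type II ($\operatorname{supp}\nu=\{0\}$ and $\mathfrak c=0$). An operator on a complex Hilbert space is called subnormal if it is the restriction of a normal operator, on a Hilbert space containing the given one isometrically, to an invariant subspace; two operators $A$, $B$ are similar if $XA=BX$ for some bounded bijective operator $X$. (a) If $W$ is not subnormal, then $W$ is not similar to any subnormal operator on any complex Hilbert space. (b) Consequently there is a dichotomy: exactly one of the following holds: $W$ is subnormal, or $W$ is not similar to any subnormal operator. -/

import Mathlib

open MeasureTheory
open scoped ENNReal NNReal ComplexOrder InnerProductSpace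

/-- The Hilbert space of square summable complex sequences indexed by `ℕ`. -/
abbrev Ell2 : Type := lp (fun _ : ℕ => ℂ) 2

/-- The standard orthonormal basis vectors of `Ell2`. -/
noncomputable def stdVec (n : ℕ) : Ell2 := lp.single 2 n (1 : ℂ)

/-- A real sequence is conditionally positive definite if
`∑_{i,j ≤ k} γ_{i+j} c_i conj(c_j) ≥ 0` for all finite complex sequences `c_0, …, c_k` with sum
zero. (For complex numbers `0 ≤ z` means that `z` is real and nonnegative.) -/
def IsCPDSeq (γ : ℕ → ℝ) : Prop :=
  ∀ (k : ℕ) (c : ℕ → ℂ), ∑ j ∈ Finset.range (k + 1), c j = 0 →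
    0 ≤ ∑ i ∈ Finset.range (k + 1), ∑ j ∈ Finset.range (k + 1),
      (γ (i + j) : ℂ) * c i * (starRingEnd ℂ) (c j)

universe u v

section Operators

variable {H : Type u} [NormedAddCommGroup H] [InnerProductSpace ℂ H]
variable {K : Type v} [NormedAddCommGroup K] [InnerProductSpace ℂ K]

/-- A bounded operator `T` is conditionally positive definite if all the sequences
`n ↦ ‖T ^ n h‖ ^ 2` are. -/
def IsCPDOperator (T : H →L[ℂ] H) : Prop :=
  ∀ h : H, IsCPDSeq (fun n => ‖(T ^ n) h‖ ^ 2)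

/-- A bounded operator is subnormal if it extends to a normal operator on a Hilbert space
containing the given one, via an isometric embedding `V`. -/
def IsSubnormal (T : H →L[ℂ] H) : Prop :=
  ∃ (L : Type u) (_ : NormedAddCommGroup L) (_ : InnerProductSpace ℂ L) (_ : CompleteSpace L)
    (N : L →L[ℂ] L) (V : H →ₗᵢ[ℂ] L), IsStarNormal N ∧ ∀ h : H, V (T h) = N (V h)

/-- Two bounded operators are similar if they are intertwined by a bounded bijective operator
(whose inverse is then automatically bounded, on Hilbert spaces). -/
def AreSimilar (A : H →L[ℂ] H) (B : K →L[ℂ] K) : Prop :=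
  ∃ X : H →L[ℂ] K, Function.Bijective X ∧ ∀ h : H, X (A h) = B (X h)

end Operators

/-- `W` is the (bounded) unilateral weighted shift on `Ell2` with positive weights `w`. Boundedness
of `W` forces the sequence `w` to be bounded, and `w` determines `W`. -/
def IsWeightedShift (w : ℕ → ℝ) (W : Ell2 →L[ℂ] Ell2) : Prop :=
  (∀ n, 0 < w n) ∧ ∀ n, W (stdVec n) = (w n : ℂ) • stdVec (n + 1)

/-- The formal moment sequence `1, w_0 ^ 2, w_0 ^ 2 w_1 ^ 2, …` of the weights `w`. -/
def momentSeq (w : ℕ → ℝ) (n : ℕ) : ℝ := ∏ j ∈ Finset.range n, w j ^ 2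

/-- The polynomial `Q_n(x) = ∑_{j=0}^{n-2} (n - j - 1) x ^ j`, with `Q_0 = Q_1 = 0`. -/
def polyQ (n : ℕ) (x : ℝ) : ℝ := ∑ j ∈ Finset.range (n - 1), ((n : ℝ) - j - 1) * x ^ j

/-- `(b, c, ν)` is the scalar representing triplet of the weighted shift with weights `w`:
`c ≥ 0`, `ν` is a finite compactly supported Borel measure on `[0, ∞)` with `ν {1} = 0`, and
`momentSeq w n = 1 + b n + c n ^ 2 + ∫ Q_n dν` for all `n`. -/
structure IsScalarTriplet (w : ℕ → ℝ) (b c : ℝ) (ν : Measure ℝ≥0) : Prop where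
  c_nonneg : 0 ≤ c
  finite : IsFiniteMeasure ν
  compact_support : IsCompact ν.support
  one_null : ν {1} = 0
  moment_eq : ∀ n : ℕ,
    momentSeq w n = 1 + b * n + c * (n : ℝ) ^ 2 + ∫ x : ℝ≥0, polyQ n (x : ℝ) ∂ν

/-- Type I: `ν = 0` and `c = 0` in the (unique) scalar representing triplet. -/
def IsTypeI (w : ℕ → ℝ) : Prop :=
  ∃ (b c : ℝ) (ν : Measure ℝ≥0), IsScalarTriplet w b c ν ∧ ν = 0 ∧ c = 0

/-- Type II: `supp ν = {0}` and `c = 0` in the (unique) scalar representing triplet. -/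
def IsTypeII (w : ℕ → ℝ) : Prop :=
  ∃ (b c : ℝ) (ν : Measure ℝ≥0), IsScalarTriplet w b c ν ∧ ν.support = {0} ∧ c = 0

/-- `T` is similar to some subnormal operator on some complex Hilbert space. -/
def IsSimilarToSubnormal {H : Type u} [NormedAddCommGroup H] [InnerProductSpace ℂ H]
    (T : H →L[ℂ] H) : Prop :=
  ∃ (K : Type v) (_ : NormedAddCommGroup K) (_ : InnerProductSpace ℂ K) (_ : CompleteSpace K)
    (S : K →L[ℂ] K), IsSubnormal S ∧ AreSimilar T S

/-! ### Growth of log-convex sequences. -/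

section SequenceGrowth

/-! For types I and II, the moments `γ n = ‖W ^ n e_0‖ ^ 2` are affine, `a + b * n` for `n ≥ 1`,
with `a ≤ 1`. If `X` intertwines `W` with a subnormal `S`, then `s n = ‖S ^ n X e_0‖` is log-convex,
because subnormal operators are paranormal, and `s n ^ 2` is comparable to `γ n`. A positive
log-convex sequence either never increases or eventually grows at least geometrically, so linear
growth of `s n ^ 2` is impossible and `b ≤ 0`; positivity of `γ` gives `b ≥ 0`. Hence `γ n = a ≤ 1`
for `n ≥ 1`: the weights are `w 0 ≤ 1` followed by ones, and such a shift has an explicit normal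
extension (bilateral shift plus zero). -/

/-- A log-convex sequence of positive reals cannot be comparable to the square roots of an
unbounded affine sequence. -/
theorem nonpos_of_logConvex_comparable_affine {s : ℕ → ℝ} {c C a b : ℝ}
    (hpos : ∀ n, 0 < s n) (hlog : ∀ n, s (n + 1) ^ 2 ≤ s n * s (n + 2)) (hc : 0 < c)
    (hlow : ∀ n, 1 ≤ n → c * (a + b * n) ≤ s n ^ 2)
    (hup : ∀ n, 1 ≤ n → s n ^ 2 ≤ C * (a + b * n)) : b ≤ 0 := by
  by_contra! hb
  by_cases hmono : ∀ n, s (n + 1) ≤ s n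
  · have hanti : Antitone s := antitone_nat_of_succ_le hmono
    obtain ⟨n, hn⟩ := exists_nat_gt ((s 0 ^ 2 / c - a) / b)
    have h1 : s (n + 1) ^ 2 ≤ s 0 ^ 2 :=
      pow_le_pow_left₀ (hpos _).le (hanti (Nat.zero_le _)) 2
    have h2 := hlow (n + 1) (by omega)
    rw [div_lt_iff₀ hb] at hn
    push_cast at h2
    have h3 : s 0 ^ 2 / c < a + b * (n + 1) := by linarith
    rw [div_lt_iff₀ hc] at h3
    linarith
  · push Not at hmono
    obtain ⟨N, hN⟩ := hmono
    set r := s (N + 1) / s N with hr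
    have hr1 : 1 < r := (one_lt_div (hpos N)).2 hN
    -- Log-convexity makes successive ratios nondecreasing, so one ratio above 1 persists.
    have hratio : ∀ k, r * s (N + k) ≤ s (N + k + 1) := by
      intro k
      induction k with
      | zero => simp [hr, div_mul_cancel₀ _ (hpos N).ne']
      | succ k ih =>
        have h1 := hlog (N + k)
        have h2 : r * s (N + k) * s (N + k + 2) ≤ s (N + k + 1) * s (N + k + 2) :=
          mul_le_mul_of_nonneg_right ih (hpos _).le
        have h3 : r * s (N + k + 1) ^ 2 ≤ r * (s (N + k) * s (N + k + 2)) :=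
          mul_le_mul_of_nonneg_left h1 (by linarith)
        have h4 : s (N + k + 1) * (r * s (N + k + 1)) ≤ s (N + k + 1) * s (N + k + 2) := by
          nlinarith
        exact le_of_mul_le_mul_left h4 (hpos _)
    have hgeom : ∀ k, r ^ k * s N ≤ s (N + k) := by
      intro k
      induction k with
      | zero => simp
      | succ k ih =>
        calc r ^ (k + 1) * s N = r * (r ^ k * s N) := by ring
          _ ≤ r * s (N + k) := mul_le_mul_of_nonneg_left ih (by linarith)
          _ ≤ _ := hratio k
    have hq : 1 < r ^ 2 := one_lt_pow₀ hr1 (by norm_num)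
    -- The affine upper bound over `r ^ (2 * k)`, split by powers of `k`, tends to 0, whereas `s (N
    -- + k) ^ 2` over it stays at least `s N ^ 2`.
    have hlim : Filter.Tendsto (fun k : ℕ => C * (a + b * N) * ((k : ℝ) ^ 0 / (r ^ 2) ^ k) +
        C * b * ((k : ℝ) ^ 1 / (r ^ 2) ^ k)) Filter.atTop (nhds 0) := by
      simpa using ((tendsto_pow_const_div_const_pow_of_one_lt 0 hq).const_mul
        (C * (a + b * N))).add
        ((tendsto_pow_const_div_const_pow_of_one_lt 1 hq).const_mul (C * b))
    have hev := hlim.eventually_lt_const (pow_pos (hpos N) 2)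
    obtain ⟨k, hk, hk1⟩ := (hev.and (Filter.eventually_ge_atTop 1)).exists
    have h1 := hup (N + k) (by omega)
    have h2 : (r ^ k * s N) ^ 2 ≤ s (N + k) ^ 2 :=
      pow_le_pow_left₀ (mul_nonneg (pow_nonneg (by linarith) _) (hpos N).le) (hgeom k) 2
    have hP : 0 < (r ^ 2) ^ k := by positivity
    have h3 : C * (a + b * N) * ((k : ℝ) ^ 0 / (r ^ 2) ^ k) +
        C * b * ((k : ℝ) ^ 1 / (r ^ 2) ^ k) = C * (a + b * ((N + k : ℕ) : ℝ)) / (r ^ 2) ^ k := by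
      push_cast
      field_simp
      ring
    rw [h3, div_lt_iff₀ hP] at hk
    have h4 : (r ^ k * s N) ^ 2 = s N ^ 2 * (r ^ 2) ^ k := by ring
    linarith

end SequenceGrowth

/-! ### Paranormality and change of universe. -/

section Subnormal

variable {H : Type u} [NormedAddCommGroup H] [InnerProductSpace ℂ H]

/-- A subnormal operator is paranormal. -/
theorem IsSubnormal.norm_apply_sq_le {T : H →L[ℂ] H} (hT : IsSubnormal T) (x : H) :
    ‖T x‖ ^ 2 ≤ ‖x‖ * ‖T (T x)‖ := by
  obtain ⟨L, _, _, _, N, V, hN, hV⟩ := hT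
  have h1 : ‖T x‖ = ‖N (V x)‖ := by rw [← hV, V.norm_map]
  have h2 : ‖T (T x)‖ = ‖N (N (V x))‖ := by rw [← hV, ← hV, V.norm_map]
  -- Normality replaces `‖N y‖` by `‖N* y‖` at `y = N (V x)`; Cauchy–Schwarz then finishes.
  rw [h1, h2, ← V.norm_map x, (ContinuousLinearMap.isStarNormal_iff_norm_eq_adjoint.1 hN) (N (V x))]
  have h3 : ((‖N (V x)‖ ^ 2 : ℝ) : ℂ) = ⟪V x, N.adjoint (N (V x))⟫_ℂ := by
    rw [ContinuousLinearMap.adjoint_inner_right, inner_self_eq_norm_sq_to_K]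
    simp
  calc ‖N (V x)‖ ^ 2 = ‖⟪V x, N.adjoint (N (V x))⟫_ℂ‖ := by
        rw [← h3, Complex.norm_real, Real.norm_of_nonneg (sq_nonneg _)]
    _ ≤ _ := norm_inner_le_norm _ _

noncomputable instance ULift.instInnerProductSpace : InnerProductSpace ℂ (ULift.{v} H) where
  inner x y := ⟪x.down, y.down⟫_ℂ
  norm_sq_eq_re_inner x := norm_sq_eq_re_inner x.down
  conj_inner_symm x y := inner_conj_symm x.down y.down
  add_left x y z := inner_add_left x.down y.down z.down
  smul_left x y r := inner_smul_left x.down y.down r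

/-- A subnormal operator on a Hilbert space is similar to a subnormal operator on its lift to
any larger universe. -/
theorem IsSubnormal.isSimilarToSubnormal [CompleteSpace H] {T : H →L[ℂ] H} (hT : IsSubnormal T) :
    IsSimilarToSubnormal.{u, max u v} T := by
  obtain ⟨L, _, _, _, N, V, hN, hV⟩ := hT
  let eH : ULift.{max u v} H ≃ₗᵢ[ℂ] H := LinearIsometryEquiv.ulift ℂ H
  let eL : ULift.{max u v} L ≃ₗᵢ[ℂ] L := LinearIsometryEquiv.ulift ℂ L
  let N' : ULift.{max u v} L →L[ℂ] ULift.{max u v} L :=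
    eL.symm.toContinuousLinearEquiv.toContinuousLinearMap ∘L N ∘L
      eL.toContinuousLinearEquiv.toContinuousLinearMap
  let N'' : ULift.{max u v} L →L[ℂ] ULift.{max u v} L :=
    eL.symm.toContinuousLinearEquiv.toContinuousLinearMap ∘L N.adjoint ∘L
      eL.toContinuousLinearEquiv.toContinuousLinearMap
  have hadj : N'.adjoint = N'' := by
    symm
    rw [ContinuousLinearMap.eq_adjoint_iff]
    intro x y
    exact N.adjoint_inner_left y.down x.down
  refine ⟨ULift.{max u v} H, inferInstance, inferInstance, inferInstance,
    eH.symm.toContinuousLinearEquiv.toContinuousLinearMap ∘L T ∘L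
      eH.toContinuousLinearEquiv.toContinuousLinearMap,
    ⟨ULift.{max u v} L, inferInstance, inferInstance, inferInstance, N',
      eL.symm.toLinearIsometry.comp (V.comp eH.toLinearIsometry), ?_, ?_⟩,
    eH.symm.toContinuousLinearEquiv.toContinuousLinearMap, eH.symm.bijective, fun h => rfl⟩
  · rw [ContinuousLinearMap.isStarNormal_iff_norm_eq_adjoint] at hN ⊢
    intro x
    rw [hadj]
    exact hN x.down
  · intro h
    exact congrArg ULift.up (hV h.down)

end Subnormal

/-! ### Permutation operators and normality. -/

section HilbertSequenceSpace

variable {ι : Type u} [DecidableEq ι]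

theorem clm_ext_single {F : Type v} [NormedAddCommGroup F] [InnerProductSpace ℂ F]
    {A B : lp (fun _ : ι => ℂ) 2 →L[ℂ] F}
    (h : ∀ i, A (lp.single 2 i 1) = B (lp.single 2 i 1)) : A = B := by
  refine lp.ext_continuousLinearMap (by simp) fun i => ?_
  ext
  exact h i

theorem orthonormal_single : Orthonormal ℂ fun i : ι => (lp.single 2 i 1 : lp (fun _ : ι => ℂ) 2) := by
  rw [orthonormal_iff_ite]
  intro i j
  rw [lp.inner_single_left, lp.single_apply]
  simp [Pi.single_apply]

/-- The isometric embedding of a sequence space attached to an orthonormal family. -/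
noncomputable def orthonormalIsometry {E : Type v} [NormedAddCommGroup E] [InnerProductSpace ℂ E]
    [CompleteSpace E] {f : ι → E} (hf : Orthonormal ℂ f) : lp (fun _ : ι => ℂ) 2 →ₗᵢ[ℂ] E :=
  hf.orthogonalFamily.linearIsometry

theorem orthonormalIsometry_single {E : Type v} [NormedAddCommGroup E] [InnerProductSpace ℂ E]
    [CompleteSpace E] {f : ι → E} (hf : Orthonormal ℂ f) (i : ι) :
    orthonormalIsometry hf (lp.single 2 i 1) = f i := by
  rw [orthonormalIsometry, OrthogonalFamily.linearIsometry_apply_single]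
  simp

/-- The operator permuting the standard basis. -/
noncomputable def permOp (σ : Equiv.Perm ι) :
    lp (fun _ : ι => ℂ) 2 →L[ℂ] lp (fun _ : ι => ℂ) 2 :=
  (orthonormalIsometry (orthonormal_single.comp σ σ.injective)).toContinuousLinearMap

theorem permOp_single (σ : Equiv.Perm ι) (i : ι) :
    permOp σ (lp.single 2 i 1) = lp.single 2 (σ i) 1 :=
  orthonormalIsometry_single (orthonormal_single.comp σ σ.injective) i

/-- The adjoint is a left inverse of an isometry; a right inverse must coincide with it. -/
theorem adjoint_permOp (σ : Equiv.Perm ι) : (permOp σ).adjoint = permOp σ.symm := by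
  have h1 : (permOp σ).adjoint ∘L permOp σ = 1 := by
    rw [← ContinuousLinearMap.norm_map_iff_adjoint_comp_self]
    exact fun x => LinearIsometry.norm_map _ x
  have h2 : permOp σ ∘L permOp σ.symm = 1 := clm_ext_single fun i => by simp [permOp_single]
  calc (permOp σ).adjoint = (permOp σ).adjoint ∘L (permOp σ ∘L permOp σ.symm) := by
        rw [h2]; rfl
    _ = permOp σ.symm := by rw [← ContinuousLinearMap.comp_assoc, h1]; rfl

/-- The operator permuting the standard basis, composed with the projection killing one fixed
basis vector. -/
noncomputable def truncPermOp (σ : Equiv.Perm ι) (p : ι) :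
    lp (fun _ : ι => ℂ) 2 →L[ℂ] lp (fun _ : ι => ℂ) 2 :=
  permOp σ ∘L (ℂ ∙ (lp.single 2 p 1 : lp (fun _ : ι => ℂ) 2))ᗮ.starProjection

theorem starProjection_orthogonal_single (p i : ι) :
    (ℂ ∙ (lp.single 2 p 1 : lp (fun _ : ι => ℂ) 2))ᗮ.starProjection (lp.single 2 i 1) =
      if i = p then 0 else lp.single 2 i 1 := by
  rw [Submodule.starProjection_orthogonal_val,
    Submodule.starProjection_unit_singleton ℂ (orthonormal_single.1 p),
    orthonormal_iff_ite.1 orthonormal_single p i]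
  by_cases h : i = p
  · simp [h]
  · simp [h, Ne.symm h]

theorem truncPermOp_single (σ : Equiv.Perm ι) (p i : ι) :
    truncPermOp σ p (lp.single 2 i 1) = if i = p then 0 else lp.single 2 (σ i) 1 := by
  rw [truncPermOp, ContinuousLinearMap.comp_apply, starProjection_orthogonal_single]
  split_ifs
  · simp
  · exact permOp_single σ i

/-- As `σ` fixes `p`, the projection commutes with the permutation; both products of the operator
with its adjoint are that projection. -/
theorem isStarNormal_truncPermOp {σ : Equiv.Perm ι} {p : ι} (hσ : σ p = p) :
    IsStarNormal (truncPermOp σ p) := by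
  have hσ' : σ.symm p = p := by rw [Equiv.symm_apply_eq, hσ]
  have hadj : (truncPermOp σ p).adjoint = truncPermOp σ.symm p := by
    rw [truncPermOp, ContinuousLinearMap.adjoint_comp, adjoint_permOp,
      (isSelfAdjoint_starProjection _).adjoint_eq]
    refine clm_ext_single fun i => ?_
    rw [truncPermOp_single, ContinuousLinearMap.comp_apply, permOp_single,
      starProjection_orthogonal_single]
    simp only [Equiv.symm_apply_eq, hσ]
  refine ⟨?_⟩
  rw [ContinuousLinearMap.star_eq_adjoint, hadj]
  refine clm_ext_single fun i => ?_
  simp only [mul_apply_eq_comp, truncPermOp_single]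
  by_cases h : i = p
  · simp [h]
  · have h1 : σ i ≠ p := fun h' => h (σ.injective (h'.trans hσ.symm))
    have h2 : σ.symm i ≠ p := fun h' => h (σ.symm.injective (h'.trans hσ'.symm))
    simp [h, truncPermOp_single, h1, h2]

end HilbertSequenceSpace

/-! ### Weighted shifts and the dichotomy. -/

section WeightedShift

/-- The normal extension acts as the bilateral shift on the coordinates `some k` and vanishes on
the coordinate `none`. -/
theorem isSubnormal_of_weights {w : ℕ → ℝ} {W : Ell2 →L[ℂ] Ell2} (hW : IsWeightedShift w W)
    (h0 : w 0 ≤ 1) (h1 : ∀ n, 1 ≤ n → w n = 1) : IsSubnormal W := by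
  let σ : Equiv.Perm (Option ℤ) := Equiv.optionCongr (Equiv.addRight 1)
  let e : Option ℤ → lp (fun _ : Option ℤ => ℂ) 2 := fun i => lp.single 2 i 1
  have he : Orthonormal ℂ e := orthonormal_single
  have hin := orthonormal_iff_ite.1 he
  -- The component along `e none` normalizes the image of `e_0` and is killed by the extension,
  -- leaving exactly `w 0 • e (some 1)`.
  let f : ℕ → lp (fun _ : Option ℤ => ℂ) 2 := fun n =>
    if n = 0 then (w 0 : ℂ) • e (some 0) + (Real.sqrt (1 - w 0 ^ 2) : ℂ) • e none
    else e (some n)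
  have hsq : w 0 ^ 2 ≤ 1 := pow_le_one₀ (hW.1 0).le h0
  have hf : Orthonormal ℂ f := by
    rw [orthonormal_iff_ite]
    intro i j
    by_cases hi : i = 0 <;> by_cases hj : j = 0
    · have h2 : (Real.sqrt (1 - w 0 ^ 2) : ℂ) * (Real.sqrt (1 - w 0 ^ 2) : ℂ) =
          1 - (w 0 : ℂ) ^ 2 := by
        rw [← Complex.ofReal_mul, Real.mul_self_sqrt (by linarith)]
        push_cast
        ring
      simp only [f, hi, hj, if_true, inner_add_left, inner_add_right, inner_smul_left,
        inner_smul_right, hin, Complex.conj_ofReal]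
      simp only [reduceCtorEq, if_false, mul_zero, mul_one, add_zero, zero_add]
      rw [h2]
      ring
    · simp [f, hi, hj, inner_add_left, hin, Ne.symm hj]
      exact fun h => (hj (by exact_mod_cast h.symm)).elim
    · simp [f, hi, hj, inner_add_right, hin]
    · simp [f, hi, hj, hin]
  refine ⟨lp (fun _ : Option ℤ => ℂ) 2, inferInstance, inferInstance, inferInstance,
    truncPermOp σ none, orthonormalIsometry hf, isStarNormal_truncPermOp rfl, ?_⟩
  have key : (orthonormalIsometry hf).toContinuousLinearMap ∘L W =
      truncPermOp σ none ∘L (orthonormalIsometry hf).toContinuousLinearMap := by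
    refine clm_ext_single fun n => ?_
    have hWn : W (lp.single 2 n 1) = (w n : ℂ) • lp.single 2 (n + 1) 1 := hW.2 n
    have hNe : ∀ k : ℤ, truncPermOp σ none (e (some k)) = e (some (k + 1)) := fun k => by
      simp [e, truncPermOp_single, σ]
    have hNn : truncPermOp σ none (e none) = 0 := by
      simp [e, truncPermOp_single]
    rw [ContinuousLinearMap.comp_apply, ContinuousLinearMap.comp_apply, hWn, map_smul]
    simp only [LinearIsometry.coe_toContinuousLinearMap, orthonormalIsometry_single]
    by_cases hn : n = 0
    · subst hn
      simp only [f, if_true, map_add, map_smul, hNe, hNn, smul_zero, add_zero]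
      simp only [zero_add, one_ne_zero, if_false, Nat.cast_one]
    · simp [f, hn, hNe, h1 n (by omega)]
  exact fun h => DFunLike.congr_fun key h

theorem norm_pow_stdVec_zero {w : ℕ → ℝ} {W : Ell2 →L[ℂ] Ell2} (hW : IsWeightedShift w W) (n : ℕ) :
    ‖(W ^ n) (stdVec 0)‖ ^ 2 = momentSeq w n := by
  have h : (W ^ n) (stdVec 0) = ((∏ j ∈ Finset.range n, w j : ℝ) : ℂ) • stdVec n := by
    induction n with
    | zero => simp
    | succ n ih =>
      rw [pow_succ', mul_apply_eq_comp, ih, map_smul, hW.2, smul_smul,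
        Finset.prod_range_succ]
      push_cast
      rfl
  have h1 : ‖stdVec n‖ = 1 := orthonormal_single.1 n
  rw [h, norm_smul, h1, mul_one, Complex.norm_real, Real.norm_eq_abs, sq_abs, momentSeq,
    Finset.prod_pow]

/-- Only the constant term survives. At `n = 0` the formula fails, since `Q_0 = 0`; hence the
restriction to `n ≥ 1` later on. -/
theorem polyQ_zero_right {n : ℕ} (hn : 1 ≤ n) : polyQ n 0 = n - 1 := by
  rw [polyQ]
  rcases Nat.lt_or_ge n 2 with h | h
  · obtain rfl : n = 1 := by omega
    simp
  · rw [Finset.sum_eq_single 0]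
    · simp
    · intro j _ hj
      simp [hj]
    · intro h'
      simp at h'
      omega

/-- In type II, a mass `m` at 0 contributes `m * (n - 1)`, so `a = 1 - m ≤ 1`. This bound later
yields `w 0 ≤ 1`. -/
theorem momentSeq_affine {w : ℕ → ℝ} (h : IsTypeI w ∨ IsTypeII w) :
    ∃ a b : ℝ, a ≤ 1 ∧ ∀ n, 1 ≤ n → momentSeq w n = a + b * n := by
  rcases h with ⟨b, c, ν, hT, rfl, rfl⟩ | ⟨b, c, ν, hT, hs, rfl⟩
  · exact ⟨1, b, le_rfl, fun n _ => by simpa using hT.moment_eq n⟩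
  · have := hT.finite
    refine ⟨1 - ν.real Set.univ, b + ν.real Set.univ, sub_le_self _ measureReal_nonneg, fun n hn => ?_⟩
    have hae : (fun x : ℝ≥0 => polyQ n (x : ℝ)) =ᵐ[ν] fun _ => (n : ℝ) - 1 := by
      have h0 : ν.support ∈ ae ν := Measure.support_mem_ae
      rw [hs] at h0
      filter_upwards [h0] with x hx
      rw [Set.mem_singleton_iff.1 hx, NNReal.coe_zero, polyQ_zero_right hn]
    rw [hT.moment_eq n, integral_congr_ae hae, integral_const, smul_eq_mul]
    ring

theorem momentSeq_pos {w : ℕ → ℝ} (hw : ∀ n, 0 < w n) (n : ℕ) : 0 < momentSeq w n :=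
  Finset.prod_pos fun j _ => pow_pos (hw j) 2

theorem weights_of_momentSeq_const {w : ℕ → ℝ} (hw : ∀ n, 0 < w n) {a : ℝ} (ha : a ≤ 1)
    (h : ∀ n, 1 ≤ n → momentSeq w n = a) : w 0 ≤ 1 ∧ ∀ n, 1 ≤ n → w n = 1 := by
  constructor
  · have h1 := h 1 le_rfl
    simp only [momentSeq, Finset.prod_range_one] at h1
    exact (sq_le_one_iff₀ (hw 0).le).1 (h1.trans_le ha)
  · intro n hn
    have h1 := h (n + 1) (by omega)
    rw [momentSeq, Finset.prod_range_succ, ← momentSeq, ← h n hn] at h1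
    have h2 : w n ^ 2 = 1 := mul_left_cancel₀ (momentSeq_pos hw n).ne' (by linarith)
    exact (pow_eq_one_iff_of_nonneg (hw n).le two_ne_zero).1 h2

/-- A bijective bounded operator between Hilbert spaces is bounded above and below. -/
theorem exists_norm_bounds_of_bijective {H : Type u} [NormedAddCommGroup H] [InnerProductSpace ℂ H]
    [CompleteSpace H] {K : Type v} [NormedAddCommGroup K] [InnerProductSpace ℂ K] [CompleteSpace K]
    (X : H →L[ℂ] K) (hX : Function.Bijective X) :
    ∃ c C : ℝ, 0 < c ∧ ∀ h, c * ‖h‖ ^ 2 ≤ ‖X h‖ ^ 2 ∧ ‖X h‖ ^ 2 ≤ C * ‖h‖ ^ 2 := by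
  let E := ContinuousLinearEquiv.ofBijective X (LinearMap.ker_eq_bot.2 hX.1)
    (LinearMap.range_eq_top.2 hX.2)
  have hE : ∀ h, E.symm (X h) = h := fun h => E.symm_apply_apply h
  set M := ‖(E.symm : K →L[ℂ] H)‖ + 1 with hM
  have hMpos : 0 < M := by positivity
  refine ⟨(M ^ 2)⁻¹, ‖X‖ ^ 2, by positivity, fun h => ⟨?_, ?_⟩⟩
  · rw [inv_mul_le_iff₀ (by positivity), ← mul_pow]
    refine pow_le_pow_left₀ (norm_nonneg _) ?_ 2
    calc ‖h‖ = ‖(E.symm : K →L[ℂ] H) (X h)‖ := by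
          rw [ContinuousLinearEquiv.coe_coe, hE]
      _ ≤ ‖(E.symm : K →L[ℂ] H)‖ * ‖X h‖ := ContinuousLinearMap.le_opNorm _ _
      _ ≤ M * ‖X h‖ := by gcongr; linarith
  · rw [← mul_pow]
    exact pow_le_pow_left₀ (norm_nonneg _) (X.le_opNorm h) 2

theorem isSubnormal_of_areSimilar {w : ℕ → ℝ} {W : Ell2 →L[ℂ] Ell2} (hW : IsWeightedShift w W)
    (htype : IsTypeI w ∨ IsTypeII w) {K : Type v} [NormedAddCommGroup K] [InnerProductSpace ℂ K]
    [CompleteSpace K] {S : K →L[ℂ] K} (hS : IsSubnormal S) (hWS : AreSimilar W S) :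
    IsSubnormal W := by
  obtain ⟨a, b, ha, hab⟩ := momentSeq_affine htype
  obtain ⟨X, hX, hint⟩ := hWS
  obtain ⟨c, C, hc, hbd⟩ := exists_norm_bounds_of_bijective X hX
  have hpow : ∀ n, X ((W ^ n) (stdVec 0)) = (S ^ n) (X (stdVec 0)) := by
    intro n
    induction n with
    | zero => simp
    | succ n ih =>
      rw [pow_succ', pow_succ', mul_apply_eq_comp, mul_apply_eq_comp,
        hint, ih]
  have hbd' : ∀ n, c * momentSeq w n ≤ ‖(S ^ n) (X (stdVec 0))‖ ^ 2 ∧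
      ‖(S ^ n) (X (stdVec 0))‖ ^ 2 ≤ C * momentSeq w n := fun n => by
    rw [← hpow, ← norm_pow_stdVec_zero hW]
    exact hbd _
  have hb_le : b ≤ 0 := by
    refine nonpos_of_logConvex_comparable_affine (s := fun n => ‖(S ^ n) (X (stdVec 0))‖)
      (fun n => ?_) (fun n => ?_) hc (fun n hn => ?_) (fun n hn => ?_) (a := a) (C := C)
    · have h1 := (mul_pos hc (momentSeq_pos hW.1 n)).trans_le (hbd' n).1
      exact (norm_nonneg _).lt_of_ne' fun h => by
        rw [h] at h1
        norm_num at h1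
    · have h1 := hS.norm_apply_sq_le ((S ^ n) (X (stdVec 0)))
      rwa [← mul_apply_eq_comp, ← mul_apply_eq_comp, ← pow_succ', ← pow_succ'] at h1
    · rw [← hab n hn]
      exact (hbd' n).1
    · rw [← hab n hn]
      exact (hbd' n).2
  -- A negative slope would eventually make the moments negative.
  have hb_ge : 0 ≤ b := by
    by_contra! hb
    obtain ⟨n, hn⟩ := exists_nat_gt (a / -b)
    rw [div_lt_iff₀ (by linarith)] at hn
    have h1 := momentSeq_pos hW.1 (n + 1)
    rw [hab _ (by omega)] at h1
    push_cast at h1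
    nlinarith
  obtain rfl : b = 0 := le_antisymm hb_le hb_ge
  obtain ⟨h0, h1⟩ := weights_of_momentSeq_const hW.1 ha fun n hn => by simpa using hab n hn
  exact isSubnormal_of_weights hW h0 h1

end WeightedShift

theorem proposition2p8 (w : ℕ → ℝ) (W : Ell2 →L[ℂ] Ell2)
    (hW : IsWeightedShift w W) (hCPD : IsCPDOperator W) (htype : IsTypeI w ∨ IsTypeII w) :
    (¬ IsSubnormal W →
      ∀ (K : Type v) [NormedAddCommGroup K] [InnerProductSpace ℂ K] [CompleteSpace K]
        (S : K →L[ℂ] K), IsSubnormal S → ¬ AreSimilar W S) ∧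
    Xor (IsSubnormal W) (¬ IsSimilarToSubnormal.{0, v} W) := by
  refine ⟨fun hns K _ _ _ S hS hWS => hns (isSubnormal_of_areSimilar hW htype hS hWS), ?_⟩
  by_cases hs : IsSubnormal W
  -- `W` lives in universe 0, so its similar subnormal operator in universe `v` is its lift.
  · exact Or.inl ⟨hs, fun h => h hs.isSimilarToSubnormal⟩
  · refine Or.inr ⟨?_, hs⟩
    rintro ⟨K, _, _, _, S, hS, hWS⟩
    exact hs (isSubnormal_of_areSimilar hW htype hS hWS)
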